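/- Let $k$ be a field and let $Q$ be a finite quiver (finitely many vertices and arrows; loops, multiple arrows and oriented cycles are allowed). Let $kQ$ be its path algebra, with product $\beta\gamma$ of paths being the concatenation "first $\gamma$, then $\beta$" when the target of $\gamma$ is the source of $\beta$, and zero otherwise. Let $Q_n$ be the set of oriented paths of length $n$, let $yQ_nx$ be the set of those from the vertex $x$ to the vertex $y$, and let $B=kQ/\langle Q_2\rangle$, where $\langle Q_2\rangle$ is the two-sided ideal generated by the paths of length $2$. All modules are left modules. For a vertex $x$, let $S_x$ be the one-dimensional simple $B$-module on which the vertex $x$ acts as the identity and all other vertices and all arrows act as zero, let $P_x=Bx$ (the projective cover of $S_x$), and let $I_x=\mathrm{Hom}_k(xB,k)$ with action $(b\varphi)(m)=\varphi(mb)$ (the injective hull of $S_x$). (a) Suppose that $Q$ is connected (as an unoriented graph) and has more than one vertex. Let $e$ be a source (no arrow ends at $e$) and $f$ a sink (no arrow starts at $f$). Then for every $n\geq 2$ $$\dim_k \mathrm{Ext}^n_B(I_e,P_f)=|fQ_ne|.$$ (b) More generally, with no connectedness assumption, for any two vertices $x,y$ of $Q$ and every $n\geq 0$ $$\dim_k \mathrm{Ext}^n_B(S_x,S_y)=|yQ_nx|.$$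 -/

import Mathlib

open CategoryTheory

universe u₁ u₂ u₃

noncomputable section

namespace QuiverAlg

/-! ### Path algebras -/

section PathAlgebra

variable (k : Type u₁) [Field k] (V : Type u₂) [Quiver.{u₃} V]

/-- An oriented path of the quiver with vertex set `V`, bundled with its source and its target. -/
structure OPath : Type (max u₂ u₃) where
  /-- the source of the path -/
  src : V
  /-- the target of the path -/
  tgt : V
  /-- the path itself -/
  path : Quiver.Path src tgt

/-- The underlying vector space of the path algebra: its basis is the set of oriented paths
(the vertices being the paths of length `0`). -/
def PathAlgebra : Type (max u₁ u₂ u₃) := OPath V →₀ k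

instance PathAlgebra.addCommGroup : AddCommGroup (PathAlgebra k V) :=
  inferInstanceAs (AddCommGroup (OPath V →₀ k))
instance : Module k (PathAlgebra k V) := inferInstanceAs (Module k (OPath V →₀ k))

variable {V}

/-- The basis element of the path algebra given by a path. -/
def ofPath (p : OPath V) : PathAlgebra k V := Finsupp.single p (1 : k)

/-- The vertex `x`, as an element of the path algebra. -/
def vertex (x : V) : PathAlgebra k V := ofPath k ⟨x, x, Quiver.Path.nil⟩

variable {k}

/-- Linear maps out of the path algebra are determined by their values on paths. -/
theorem pathAlgebra_lhom_ext {M : Type*} [AddCommMonoid M] [Module k M]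
    {φ ψ : PathAlgebra k V →ₗ[k] M} (h : ∀ p, φ (ofPath k p) = ψ (ofPath k p)) : φ = ψ :=
  Finsupp.lhom_ext' fun p => LinearMap.ext_ring (h p)

/-- To prove a property of all elements of the path algebra that is stable under sums and scalar
multiples, it is enough to prove it for paths. -/
theorem pathAlgebra_induction {motive : PathAlgebra k V → Prop}
    (zero : motive 0) (path : ∀ p, motive (ofPath k p)) (add : ∀ a b, motive a → motive b → motive (a + b))
    (smul : ∀ (r : k) a, motive a → motive (r • a)) (a : PathAlgebra k V) : motive a := by
  refine Finsupp.induction_linear a zero add fun p r => ?_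
  have h : (Finsupp.single p r : OPath V →₀ k) = (r • ofPath k p : PathAlgebra k V) :=
    (Finsupp.smul_single_one p r).symm
  exact h ▸ smul r _ (path p)

variable (k)

/-- The linear extension to the path algebra of a map defined on paths. -/
def extend {M : Type*} [AddCommMonoid M] [Module k M] (F : OPath V → M) :
    PathAlgebra k V →ₗ[k] M :=
  Finsupp.linearCombination k F

@[simp] theorem extend_ofPath {M : Type*} [AddCommMonoid M] [Module k M] (F : OPath V → M)
    (p : OPath V) : extend k F (ofPath k p) = F p := by
  exact (Finsupp.linearCombination_single k (1 : k) p).trans (one_smul k _)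

open Classical in
/-- The product `β γ` of two paths: first `γ`, then `β`, if the target of `γ` is the source of `β`,
and zero otherwise. -/
def pathMul (β γ : OPath V) : PathAlgebra k V :=
  if h : γ.tgt = β.src then ofPath k ⟨γ.src, β.tgt, (γ.path.cast rfl h).comp β.path⟩ else 0

/-- The bilinear extension of the product of paths. -/
def mulLin : PathAlgebra k V →ₗ[k] PathAlgebra k V →ₗ[k] PathAlgebra k V :=
  extend k fun β => extend k fun γ => pathMul k β γ

theorem mulLin_ofPath (β γ : OPath V) :
    mulLin k (ofPath k β) (ofPath k γ) = pathMul k β γ := by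
  simp [mulLin]

theorem pathMul_of_eq {x y z : V} (p : Quiver.Path x y) (q : Quiver.Path y z) :
    pathMul k ⟨y, z, q⟩ ⟨x, y, p⟩ = ofPath k ⟨x, z, p.comp q⟩ := by
  simp [pathMul]

theorem pathMul_of_ne {β γ : OPath V} (h : γ.tgt ≠ β.src) : pathMul k β γ = 0 := by
  simp [pathMul, h]

theorem mulLin_assoc_ofPath (α β γ : OPath V) :
    mulLin k (mulLin k (ofPath k α) (ofPath k β)) (ofPath k γ) =
      mulLin k (ofPath k α) (mulLin k (ofPath k β) (ofPath k γ)) := by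
  obtain ⟨a, b, p⟩ := α
  obtain ⟨c, d, q⟩ := β
  obtain ⟨e, f, r⟩ := γ
  simp only [mulLin_ofPath]
  by_cases h₁ : d = a
  · subst h₁
    rw [pathMul_of_eq, mulLin_ofPath]
    by_cases h₂ : f = c
    · subst h₂
      rw [pathMul_of_eq, pathMul_of_eq, mulLin_ofPath, pathMul_of_eq, Quiver.Path.comp_assoc]
    · rw [pathMul_of_ne k h₂, pathMul_of_ne k h₂, map_zero]
  · rw [pathMul_of_ne k h₁, map_zero, LinearMap.zero_apply]
    by_cases h₂ : f = c
    · subst h₂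
      rw [pathMul_of_eq, mulLin_ofPath, pathMul_of_ne k h₁]
    · rw [pathMul_of_ne k h₂, map_zero]

theorem mulLin_assoc (a b c : PathAlgebra k V) :
    mulLin k (mulLin k a b) c = mulLin k a (mulLin k b c) := by
  induction a using pathAlgebra_induction with
  | zero => simp only [map_zero, LinearMap.zero_apply]
  | add a a' ha ha' => simp only [map_add, LinearMap.add_apply, ha, ha']
  | smul r a ha => simp only [map_smul, LinearMap.smul_apply, ha]
  | path α =>
    induction b using pathAlgebra_induction with
    | zero => simp only [map_zero, LinearMap.zero_apply]
    | add b b' hb hb' => simp only [map_add, LinearMap.add_apply, hb, hb']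
    | smul r b hb => simp only [map_smul, LinearMap.smul_apply, hb]
    | path β =>
      induction c using pathAlgebra_induction with
      | zero => simp only [map_zero]
      | add c c' hc hc' => simp only [map_add, hc, hc']
      | smul r c hc => simp only [map_smul, hc]
      | path γ => exact mulLin_assoc_ofPath k α β γ

variable [Fintype V]

theorem one_mulLin (a : PathAlgebra k V) : mulLin k (∑ x : V, vertex k x) a = a := by
  classical
  have key : mulLin k (∑ x : V, vertex k x) = LinearMap.id := by
    refine pathAlgebra_lhom_ext fun ⟨x, y, p⟩ => ?_
    rw [map_sum, LinearMap.sum_apply, Finset.sum_eq_single y]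
    · simp only [vertex, mulLin_ofPath, pathMul_of_eq, Quiver.Path.comp_nil, LinearMap.id_apply]
    · intro z _ hz
      rw [vertex, mulLin_ofPath, pathMul_of_ne k (Ne.symm hz)]
    · simp
  exact LinearMap.congr_fun key a

theorem mulLin_one (a : PathAlgebra k V) : mulLin k a (∑ x : V, vertex k x) = a := by
  classical
  have key : (mulLin k).flip (∑ x : V, vertex k x) = LinearMap.id := by
    refine pathAlgebra_lhom_ext fun ⟨x, y, p⟩ => ?_
    rw [map_sum, LinearMap.sum_apply, Finset.sum_eq_single x]
    · simp only [vertex, LinearMap.flip_apply, mulLin_ofPath, pathMul_of_eq,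
        Quiver.Path.nil_comp, LinearMap.id_apply]
    · intro z _ hz
      rw [vertex, LinearMap.flip_apply, mulLin_ofPath, pathMul_of_ne k hz]
    · simp
  exact LinearMap.congr_fun key a

/-- The ring structure of the path algebra; its unit is the sum of the vertices. -/
instance : Ring (PathAlgebra k V) where
  __ := PathAlgebra.addCommGroup k V
  mul a b := mulLin k a b
  one := ∑ x : V, vertex k x
  left_distrib a b c := map_add (mulLin k a) b c
  right_distrib a b c := LinearMap.map_add₂ (mulLin k) a b c
  zero_mul a := LinearMap.map_zero₂ (mulLin k) a
  mul_zero a := map_zero (mulLin k a)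
  mul_assoc := mulLin_assoc k
  one_mul := one_mulLin k
  mul_one := mulLin_one k

instance : Algebra k (PathAlgebra k V) :=
  Algebra.ofModule (fun r a b => LinearMap.map_smul₂ (mulLin k) r a b)
    (fun r a b => map_smul (mulLin k a) r b)

theorem ofPath_mul_ofPath (β γ : OPath V) : ofPath k β * ofPath k γ = pathMul k β γ :=
  mulLin_ofPath k β γ

theorem one_def : (1 : PathAlgebra k V) = ∑ x : V, vertex k x := rfl

end PathAlgebra

/-! ### Radical square zero algebras -/

section RadSqZero

variable (k : Type u₁) [Field k] (V : Type u₂) [Quiver.{u₃} V] [Fintype V]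

/-- The two-sided ideal `⟨Q₂⟩` of the path algebra generated by the paths of length `2`. -/
def idealQ₂ : TwoSidedIdeal (PathAlgebra k V) :=
  TwoSidedIdeal.span {a | ∃ p : OPath V, p.path.length = 2 ∧ a = ofPath k p}

/-- The algebra `B = kQ/⟨Q₂⟩`. -/
abbrev RadSqZero : Type (max u₁ u₂ u₃) := PathAlgebra k V ⧸ (idealQ₂ k V).asIdeal

variable {V}

/-- The primitive idempotent of `B` given by the vertex `x`. -/
def idem (x : V) : RadSqZero k V := Ideal.Quotient.mk _ (vertex k x)

open Classical in
/-- The algebra morphism `kQ → k` which sends the vertex `x` to `1`, and the other vertices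
and all paths of positive length to `0`. -/
def pathChar (x : V) : PathAlgebra k V →ₐ[k] k :=
  AlgHom.ofLinearMap (extend k fun p => if p.path.length = 0 ∧ p.src = x then (1 : k) else 0)
    (by
      rw [one_def, map_sum, Finset.sum_eq_single x]
      · simp [vertex]
      · intro y _ hy
        simp [vertex, hy]
      · simp)
    (by
      intro a b
      set ε : PathAlgebra k V →ₗ[k] k :=
        extend k fun p => if p.path.length = 0 ∧ p.src = x then (1 : k) else 0 with hε
      have key : (mulLin k).compr₂ ε = (LinearMap.mul k k).compl₁₂ ε ε := by
        refine pathAlgebra_lhom_ext fun ⟨c, d, q⟩ => pathAlgebra_lhom_ext fun ⟨e, f, p⟩ => ?_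
        simp only [LinearMap.compr₂_apply, LinearMap.compl₁₂_apply, LinearMap.mul_apply',
          mulLin_ofPath]
        by_cases h : f = c
        · subst h
          rw [pathMul_of_eq]
          simp only [hε, extend_ofPath, Quiver.Path.length_comp, Nat.add_eq_zero_iff]
          by_cases hp : p.length = 0
          · have hef := Quiver.Path.eq_of_length_zero p hp
            subst hef
            by_cases hq : q.length = 0 <;> by_cases hx : e = x <;> simp [hp, hq, hx]
          · simp [hp]
        · rw [pathMul_of_ne k h, map_zero]
          simp only [hε, extend_ofPath]
          by_cases hp : p.length = 0 ∧ e = x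
          · by_cases hq : q.length = 0 ∧ c = x
            · exact absurd ((Quiver.Path.eq_of_length_zero p hp.1).symm.trans
                (hp.2.trans hq.2.symm)) h
            · simp [hq]
          · simp [hp]
      exact LinearMap.congr_fun (LinearMap.congr_fun key a) b)

theorem pathChar_eq_zero (x : V) (a : PathAlgebra k V) (ha : a ∈ (idealQ₂ k V).asIdeal) :
    pathChar k x a = 0 := by
  have h : idealQ₂ k V ≤ TwoSidedIdeal.ker (pathChar k x) := by
    refine TwoSidedIdeal.span_le.2 ?_
    rintro _ ⟨p, hp, rfl⟩
    simp [TwoSidedIdeal.mem_ker, pathChar, hp]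
  exact (TwoSidedIdeal.mem_ker _).1 (h (TwoSidedIdeal.mem_asIdeal.1 ha))

/-- The algebra morphism `B → k` by which `B` acts on the simple module at `x`. -/
def simpleChar (x : V) : RadSqZero k V →ₐ[k] k :=
  Ideal.Quotient.liftₐ _ (pathChar k x) (pathChar_eq_zero k x)

/-- The carrier of the simple module at `x`: the one dimensional space `k` (lifted to the
universe of `B`). -/
def SimpleAt (_x : V) : Type (max u₁ u₂ u₃) := ULift.{max u₂ u₃} k

instance (x : V) : AddCommGroup (SimpleAt k x) :=
  inferInstanceAs (AddCommGroup (ULift.{max u₂ u₃} k))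

/-- The vertex `x` acts on the simple module at `x` as the identity, the other vertices and the
arrows act as zero. -/
instance (x : V) : Module (RadSqZero k V) (SimpleAt k x) :=
  Module.compHom (ULift.{max u₂ u₃} k) (simpleChar k x).toRingHom

/-- The simple left `B`-module `S_x`. -/
def S (x : V) : ModuleCat.{max u₁ u₂ u₃} (RadSqZero k V) :=
  ModuleCat.of _ (SimpleAt k x)

/-- The projective left `B`-module `P_x = Bx`. -/
def P (x : V) : ModuleCat.{max u₁ u₂ u₃} (RadSqZero k V) :=
  ModuleCat.of _ (LinearMap.range (LinearMap.toSpanSingleton (RadSqZero k V) (RadSqZero k V)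
    (idem k x)))

/-- The subspace `xB` of `B`, which is a right ideal. -/
def rightIdeal (x : V) : Submodule k (RadSqZero k V) :=
  LinearMap.range (LinearMap.mulLeft k (idem k x))

/-- Right multiplication by `b` on `xB`. -/
def rightMul (x : V) (b : RadSqZero k V) : rightIdeal k x →ₗ[k] rightIdeal k x :=
  (LinearMap.mulRight k b).restrict (by
    rintro _ ⟨c, rfl⟩
    exact ⟨c * b, by simp [mul_assoc]⟩)

/-- The dual space `(xB)' = Hom_k(xB, k)`. -/
def InjectiveAt (x : V) : Type (max u₁ u₂ u₃) := rightIdeal k x →ₗ[k] k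

instance (x : V) : AddCommGroup (InjectiveAt k x) :=
  inferInstanceAs (AddCommGroup (rightIdeal k x →ₗ[k] k))

theorem rightMul_one (x : V) : rightMul k x 1 = LinearMap.id :=
  LinearMap.ext fun m => Subtype.ext (mul_one m.1)

theorem rightMul_mul (x : V) (b c : RadSqZero k V) :
    rightMul k x (b * c) = rightMul k x c ∘ₗ rightMul k x b :=
  LinearMap.ext fun m => Subtype.ext (mul_assoc m.1 b c).symm

theorem rightMul_add (x : V) (b c : RadSqZero k V) :
    rightMul k x (b + c) = rightMul k x b + rightMul k x c :=
  LinearMap.ext fun m => Subtype.ext (mul_add m.1 b c)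

theorem rightMul_zero (x : V) : rightMul k x 0 = 0 :=
  LinearMap.ext fun m => Subtype.ext (mul_zero m.1)

/-- The left action of `B` on `(xB)'`, given by `(b φ)(m) = φ(m b)`. -/
def dualSMul (x : V) (b : RadSqZero k V) (φ : rightIdeal k x →ₗ[k] k) : rightIdeal k x →ₗ[k] k :=
  φ ∘ₗ rightMul k x b

/-- The left `B`-module structure of `(xB)'`. -/
instance (x : V) : Module (RadSqZero k V) (InjectiveAt k x) where
  smul := dualSMul k x
  one_smul φ := (congrArg (LinearMap.comp (σ₂₃ := RingHom.id k) φ) (rightMul_one k x)).trans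
    (LinearMap.comp_id _)
  mul_smul b c φ :=
    congrArg (LinearMap.comp (σ₂₃ := RingHom.id k) φ) (rightMul_mul k x b c)
  smul_zero _ := LinearMap.zero_comp _
  smul_add _ _ _ := LinearMap.add_comp _ _ _
  add_smul b c φ :=
    (congrArg (LinearMap.comp (σ₂₃ := RingHom.id k) φ) (rightMul_add k x b c)).trans
      (LinearMap.comp_add _ _ _)
  zero_smul φ := (congrArg (LinearMap.comp (σ₂₃ := RingHom.id k) φ) (rightMul_zero k x)).trans
    (LinearMap.comp_zero _)

/-- The injective left `B`-module `I_x = (xB)'`. -/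
def I (x : V) : ModuleCat.{max u₁ u₂ u₃} (RadSqZero k V) :=
  ModuleCat.of _ (InjectiveAt k x)

end RadSqZero

/-! ### Quivers -/

section Quivers

variable {V : Type u₂} [Quiver.{u₃} V]

/-- A source is a vertex at which no arrow ends. -/
def IsSource (e : V) : Prop := ∀ x : V, IsEmpty (x ⟶ e)

/-- A sink is a vertex at which no arrow starts. -/
def IsSink (f : V) : Prop := ∀ x : V, IsEmpty (f ⟶ x)

/-- The set of paths of length `n` from `x` to `y`, that is `y Qₙ x`. -/
def pathsOfLength (n : ℕ) (x y : V) : Set (Quiver.Path x y) := {p | p.length = n}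

/-- In a finite quiver there are finitely many paths of given length between two vertices. -/
theorem finite_pathsOfLength [Finite V] [∀ x y : V, Finite (x ⟶ y)] (n : ℕ) (x y : V) :
    (pathsOfLength n x y).Finite := by
  induction n generalizing y with
  | zero =>
    refine Set.Subsingleton.finite fun p hp q hq => ?_
    have hxy := Quiver.Path.eq_of_length_zero p hp
    subst hxy
    rw [Quiver.Path.eq_nil_of_length_zero p hp, Quiver.Path.eq_nil_of_length_zero q hq]
  | succ n ih =>
    have : ∀ z, Finite (pathsOfLength n x z) := fun z => ih z
    refine (Set.finite_range fun t : Σ z : V, pathsOfLength n x z × (z ⟶ y) =>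
      t.2.1.1.cons t.2.2).subset ?_
    rintro p hp
    cases p with
    | nil => simp [pathsOfLength] at hp
    | cons q a => exact ⟨⟨_, ⟨q, by simpa [pathsOfLength] using hp⟩, a⟩, rfl⟩

end Quivers

end QuiverAlg

end

/-! Since products of two arrows vanish in $B$, the space $Bx$ is spanned by the vertex $x$ and the
arrows starting at $x$, and $b\in B$ multiplies an arrow $a : x \to z$ by the scalar through which
it acts on $S_z$ (`mul_idem`, `mul_arrow`). Hence the kernel of $P_x\to S_x$ is the direct sum of
the $S_z$ over the arrows $x\to z$.

Dimension shifting along $0\to\bigoplus S_z\to P_x\to S_x\to 0$ gives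
$\mathrm{Ext}^{n+1}(S_x,S_y)\cong\prod_{x\to z}\mathrm{Ext}^n(S_z,S_y)$
(`extSimpleSuccLinearEquiv`). This includes $n=0$, because every map $P_x\to S_y$ kills the radical
(`topSequence_f_comp`). Path counts satisfy the same recursion, by splitting off the first arrow,
and both sides equal $\delta_{xy}$ for $n=0$; this proves (b).

For (a), no arrow leaves $f$, so $P_f\cong S_f$; no arrow enters $e$, so $eB=ke$ and $I_e\cong S_e$.
Thus (a) is an instance of (b). -/

namespace QuiverAlg

/-! ### Functoriality of Ext and dimension shifting -/

section Ext

open Abelian Limits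

universe w v u t

variable {C : Type u} [Category.{v} C] [Abelian C] [HasExt.{w} C]
  (k : Type t) [CommRing k] [Linear k C]

/-- `Ext` turns finite biproducts in its first variable into products, linearly. -/
noncomputable def extBiproductLinearEquiv {J : Type*} [Fintype J] {X : J → C} {c : Bicone X}
    (hc : c.IsBilimit) (Y : C) (n : ℕ) : Ext c.pt Y n ≃ₗ[k] Π i, Ext (X i) Y n where
  __ := Ext.biproductAddEquiv hc Y n
  map_smul' r α := by
    ext i
    simp [Ext.biproductAddEquiv]

/-- Isomorphic objects in the first variable have linearly equivalent `Ext` modules. -/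
noncomputable def extPrecompIso {X X' : C} (i : X' ≅ X) (Y : C) (n : ℕ) :
    Ext X Y n ≃ₗ[k] Ext X' Y n :=
  LinearEquiv.ofLinearMap
    (Ext.precompOfLinear (Ext.mk₀ i.hom) k Y (zero_add n))
    (Ext.precompOfLinear (Ext.mk₀ i.inv) k Y (zero_add n))
    (by ext α; simp [← Ext.comp_assoc_of_second_deg_zero])
    (by ext α; simp [← Ext.comp_assoc_of_second_deg_zero])

/-- Isomorphic objects in the second variable have linearly equivalent `Ext` modules. -/
noncomputable def extPostcompIso {Y Y' : C} (i : Y ≅ Y') (X : C) (n : ℕ) :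
    Ext X Y n ≃ₗ[k] Ext X Y' n :=
  LinearEquiv.ofLinearMap
    (Ext.postcompOfLinear (Ext.mk₀ i.hom) k X (add_zero n))
    (Ext.postcompOfLinear (Ext.mk₀ i.inv) k X (add_zero n))
    (by ext α; simp)
    (by ext α; simp)

/-- Dimension shifting along a short exact sequence with projective middle term whose morphisms
to `Y` all vanish on the first term; it is valid in degree zero as well. -/
noncomputable def extShiftLinearEquiv {S : ShortComplex C} (hS : S.ShortExact) [Projective S.X₂]
    (Y : C) (hY : ∀ g : S.X₂ ⟶ Y, S.f ≫ g = 0) (n : ℕ) :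
    Ext S.X₁ Y n ≃ₗ[k] Ext S.X₃ Y (n + 1) :=
  LinearEquiv.ofBijective
    (Ext.precompOfLinear hS.extClass k Y (add_comm 1 n)) (by
      refine ⟨(injective_iff_map_eq_zero _).2 fun α hα => ?_, fun β => ?_⟩
      -- The kernel is the image of $\mathrm{Ext}^n(X_2,Y)$: zero by `hY` if $n=0$, by projectivity
      -- of $X_2$ otherwise.
      · obtain ⟨γ, rfl⟩ := Ext.contravariant_sequence_exact₁ hS Y α (add_comm 1 n) hα
        cases n with
        | zero =>
          obtain ⟨g, rfl⟩ := (Ext.mk₀_bijective _ _).2 γ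
          rw [Ext.mk₀_comp_mk₀, hY, Ext.mk₀_zero]
        | succ n => rw [Ext.eq_zero_of_projective γ, Ext.comp_zero]
      · exact Ext.contravariant_sequence_exact₃ hS Y β (Ext.eq_zero_of_projective _)
          (add_comm 1 n))

end Ext

/-! ### Counting paths by their first arrow -/

section Paths

variable {V : Type u₂} [Quiver.{u₃} V]

/-- The arrows starting at a vertex. -/
abbrev ArrowsFrom (x : V) : Type (max u₂ u₃) := Σ z : V, (x ⟶ z)

/-- The path of length one given by an arrow. -/
def ArrowsFrom.toOPath {x : V} (a : ArrowsFrom x) : OPath V := ⟨x, a.1, a.2.toPath⟩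

theorem ArrowsFrom.toOPath_injective (x : V) :
    Function.Injective (ArrowsFrom.toOPath : ArrowsFrom x → OPath V) := by
  rintro ⟨z, a⟩ ⟨w, b⟩ h
  simp only [ArrowsFrom.toOPath, OPath.mk.injEq] at h
  obtain ⟨-, rfl, h⟩ := h
  simpa [Quiver.Hom.toPath] using h

/-- With `lhom_ext_toB`, this reduces identities of linear maps on $B$ to vertices and arrows. -/
theorem length_lt_two_cases {motive : OPath V → Prop} (vertex : ∀ x, motive ⟨x, x, .nil⟩)
    (arrow : ∀ x (a : ArrowsFrom x), motive a.toOPath) (p : OPath V) (hp : p.path.length < 2) :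
    motive p := by
  obtain ⟨x, y, p⟩ := p
  match p, hp with
  | .nil, _ => exact vertex x
  | .cons .nil a, _ => exact arrow x ⟨_, a⟩

/-- `Quiver.Path.cons` adds arrows at the end, so the first arrow is reached by stripping final
arrows from both tails until they are empty. The tails have equal length, which rules out the mixed
cases. -/
theorem toPath_comp_injective {x y : V} {a b : ArrowsFrom x} {p : Quiver.Path a.1 y}
    {q : Quiver.Path b.1 y} (h : a.2.toPath.comp p = b.2.toPath.comp q) :
    (⟨a, p⟩ : Σ a : ArrowsFrom x, Quiver.Path a.1 y) = ⟨b, q⟩ := by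
  obtain ⟨z, a⟩ := a
  obtain ⟨w, b⟩ := b
  dsimp only at p q h
  have hl : p.length = q.length := by
    simpa using congrArg Quiver.Path.length h
  induction p with
  | nil =>
    obtain rfl := Quiver.Path.eq_of_length_zero q hl.symm
    obtain rfl := Quiver.Path.eq_nil_of_length_zero q hl.symm
    simp only [Quiver.Path.comp_nil, Quiver.Hom.toPath, Quiver.Path.cons.injEq, heq_eq_eq,
      true_and] at h
    rw [h]
  | cons p c ih =>
    cases q with
    | nil => simp at hl
    | cons q d =>
      simp only [Quiver.Path.comp_cons, Quiver.Path.cons.injEq] at h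
      obtain ⟨rfl, h, hcd⟩ := h
      obtain rfl := eq_of_heq hcd
      have := ih (eq_of_heq h) (by simpa using hl)
      simp only [Sigma.mk.injEq] at this
      obtain ⟨h₁, h₂⟩ := this
      obtain ⟨rfl, h₁⟩ := h₁
      obtain rfl := eq_of_heq h₁
      obtain rfl := eq_of_heq h₂
      rfl

/-- A path of length `n + 1` is an arrow followed by a path of length `n`. -/
noncomputable def pathsOfLengthSuccEquiv (n : ℕ) (x y : V) :
    (Σ a : ArrowsFrom x, pathsOfLength n a.1 y) ≃ pathsOfLength (n + 1) x y :=
  Equiv.ofBijective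
    (fun t => ⟨t.1.2.toPath.comp t.2.1, by
      have := t.2.2
      simp only [pathsOfLength, Set.mem_ofPred_eq] at this
      simp [pathsOfLength, this, add_comm]⟩) (by
    constructor
    · rintro ⟨a, p, hp⟩ ⟨b, q, hq⟩ h
      have := toPath_comp_injective (congrArg Subtype.val h)
      simp only [Sigma.mk.injEq] at this
      obtain ⟨rfl, h⟩ := this
      obtain rfl := eq_of_heq h
      rfl
    · rintro ⟨p, hp⟩
      obtain ⟨z, a, q, hq, rfl⟩ := Quiver.Path.eq_toPath_comp_of_length_eq_succ p hp
      exact ⟨⟨⟨z, a⟩, q, hq⟩, rfl⟩)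

theorem ncard_pathsOfLength_succ [Finite V] [∀ x y : V, Finite (x ⟶ y)] (n : ℕ) (x y : V)
    [Fintype (ArrowsFrom x)] :
    (pathsOfLength (n + 1) x y).ncard = ∑ a : ArrowsFrom x, (pathsOfLength n a.1 y).ncard := by
  have (z : V) : Finite (pathsOfLength n z y) := finite_pathsOfLength n z y
  rw [← Nat.card_coe_set_eq, ← Nat.card_congr (pathsOfLengthSuccEquiv n x y), Nat.card_sigma]
  simp only [Nat.card_coe_set_eq]

theorem pathsOfLength_zero_self (x : V) : pathsOfLength 0 x x = {Quiver.Path.nil} := by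
  ext p
  simp [pathsOfLength]

theorem pathsOfLength_zero_of_ne {x y : V} (h : x ≠ y) : pathsOfLength 0 x y = ∅ :=
  Set.eq_empty_of_forall_notMem fun p hp => h (Quiver.Path.eq_of_length_zero p hp)

end Paths

/-! ### Multiplication in $B$ on vertices and arrows -/

section Algebra

variable (k : Type u₁) [Field k] {V : Type u₂} [Quiver.{u₃} V] [Fintype V]

/-- Multiplying a path by paths on both sides gives zero or a path at least as long; the general
case follows by bilinearity. -/
theorem map_mul_ofPath_mul_eq_zero {M : Type*} [AddCommGroup M] [Module k M]
    (φ : PathAlgebra k V →ₗ[k] M) (hφ : ∀ p : OPath V, 2 ≤ p.path.length → φ (ofPath k p) = 0)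
    {p : OPath V} (hp : 2 ≤ p.path.length) (a b : PathAlgebra k V) :
    φ (a * ofPath k p * b) = 0 := by
  induction a using pathAlgebra_induction with
  | zero => simp
  | add a a' ha ha' => rw [add_mul, add_mul, map_add, ha, ha', add_zero]
  | smul r a ha => rw [smul_mul_assoc, smul_mul_assoc, map_smul, ha, smul_zero]
  | path α =>
    induction b using pathAlgebra_induction with
    | zero => simp
    | add b b' hb hb' => rw [mul_add, map_add, hb, hb', add_zero]
    | smul r b hb => rw [mul_smul_comm, map_smul, hb, smul_zero]
    | path β =>
      obtain ⟨x, y, p⟩ := p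
      obtain ⟨y', z, q⟩ := α
      obtain ⟨w, x', r⟩ := β
      rw [ofPath_mul_ofPath]
      by_cases h : y = y'
      · subst h
        rw [pathMul_of_eq, ofPath_mul_ofPath]
        by_cases h' : x' = x
        · subst h'
          rw [pathMul_of_eq]
          refine hφ _ ?_
          simp only [Quiver.Path.length_comp] at hp ⊢
          lia
        · rw [pathMul_of_ne k h', map_zero]
      · rw [pathMul_of_ne k h, zero_mul, map_zero]

/-- A linear map which vanishes on the paths of length at least two vanishes on `⟨Q₂⟩`. -/
theorem eq_zero_of_mem_idealQ₂ {M : Type*} [AddCommGroup M] [Module k M]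
    (φ : PathAlgebra k V →ₗ[k] M) (hφ : ∀ p : OPath V, 2 ≤ p.path.length → φ (ofPath k p) = 0)
    {a : PathAlgebra k V} (ha : a ∈ (idealQ₂ k V).asIdeal) : φ a = 0 := by
  have ha' := TwoSidedIdeal.mem_span_iff_mem_addSubgroup_closure.1 (TwoSidedIdeal.mem_asIdeal.1 ha)
  clear ha
  induction ha' using AddSubgroup.closure_induction with
  | zero => exact map_zero φ
  | add a b _ _ ha hb => rw [map_add, ha, hb, add_zero]
  | neg a _ ha => rw [map_neg, ha, neg_zero]
  | mem c hc =>
    obtain ⟨_, ⟨a, -, _, ⟨p, hp, rfl⟩, rfl⟩, b, -, rfl⟩ := hc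
    exact map_mul_ofPath_mul_eq_zero k φ hφ hp.ge a b

variable (V) in
/-- The projection of the path algebra onto `B`, as an algebra morphism. -/
noncomputable def toB : PathAlgebra k V →ₐ[k] RadSqZero k V := Ideal.Quotient.mkₐ k _

theorem toB_surjective : Function.Surjective (toB k V) := Ideal.Quotient.mk_surjective

theorem toB_vertex (x : V) : toB k V (vertex k x) = idem k x := rfl

/-- The last two arrows form a generator of $\langle Q_2\rangle$, and the rest of the path is a
right factor. -/
theorem toB_ofPath_eq_zero {p : OPath V} (hp : 2 ≤ p.path.length) : toB k V (ofPath k p) = 0 := by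
  refine Ideal.Quotient.eq_zero_iff_mem.2 (TwoSidedIdeal.mem_asIdeal.2 ?_)
  obtain ⟨x, y, p⟩ := p
  match p, hp with
  | .cons (.cons p a) b, _ =>
    have h : ofPath k (⟨_, _, .cons (.cons p a) b⟩ : OPath V) =
        ofPath k ⟨_, _, .cons (.cons .nil a) b⟩ * ofPath k ⟨_, _, p⟩ := by
      rw [ofPath_mul_ofPath, pathMul_of_eq]
      rfl
    rw [h]
    exact TwoSidedIdeal.mul_mem_right _ _ _ (TwoSidedIdeal.subset_span ⟨_, rfl, rfl⟩)

theorem lhom_ext_toB {M : Type*} [AddCommMonoid M] [Module k M] {φ ψ : RadSqZero k V →ₗ[k] M}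
    (h : ∀ p : OPath V, p.path.length < 2 → φ (toB k V (ofPath k p)) = ψ (toB k V (ofPath k p))) :
    φ = ψ := by
  have : φ ∘ₗ (toB k V).toLinearMap = ψ ∘ₗ (toB k V).toLinearMap := by
    refine pathAlgebra_lhom_ext fun p => ?_
    rcases lt_or_ge p.path.length 2 with hp | hp
    · exact h p hp
    · simp [toB_ofPath_eq_zero k hp]
  refine LinearMap.ext fun b => ?_
  obtain ⟨a, rfl⟩ := toB_surjective k b
  exact LinearMap.congr_fun this a

open Classical in
theorem simpleChar_toB (x : V) (p : OPath V) :
    simpleChar k x (toB k V (ofPath k p)) = if p.path.length = 0 ∧ p.src = x then 1 else 0 := by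
  change pathChar k x (ofPath k p) = _
  simp [pathChar]

/-- The arrow `a`, as an element of `B`. -/
noncomputable def arrow {x : V} (a : ArrowsFrom x) : RadSqZero k V := toB k V (ofPath k a.toOPath)

theorem simpleChar_idem_self (x : V) : simpleChar k x (idem k x) = 1 := by
  classical
  rw [← toB_vertex, vertex, simpleChar_toB]
  simp

theorem simpleChar_idem_of_ne {x y : V} (h : x ≠ y) : simpleChar k y (idem k x) = 0 := by
  classical
  rw [← toB_vertex, vertex, simpleChar_toB]
  simp [h]

theorem simpleChar_arrow {x : V} (a : ArrowsFrom x) (y : V) : simpleChar k y (arrow k a) = 0 := by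
  classical
  rw [arrow, simpleChar_toB]
  simp [ArrowsFrom.toOPath]

theorem toB_mul_eq {x y z : V} (p : Quiver.Path x y) (q : Quiver.Path y z) :
    toB k V (ofPath k ⟨y, z, q⟩) * toB k V (ofPath k ⟨x, y, p⟩) =
      toB k V (ofPath k ⟨x, z, p.comp q⟩) := by
  rw [← map_mul, ofPath_mul_ofPath, pathMul_of_eq]

theorem toB_mul_of_ne {p q : OPath V} (h : p.tgt ≠ q.src) :
    toB k V (ofPath k q) * toB k V (ofPath k p) = 0 := by
  rw [← map_mul, ofPath_mul_ofPath, pathMul_of_ne k h, map_zero]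

theorem idem_mul_idem (x : V) : idem k x * idem k x = idem k x :=
  toB_mul_eq k Quiver.Path.nil Quiver.Path.nil

theorem arrow_mul_idem {x : V} (a : ArrowsFrom x) : arrow k a * idem k x = arrow k a :=
  (toB_mul_eq k Quiver.Path.nil a.2.toPath).trans (by rw [Quiver.Path.nil_comp]; rfl)

/-- `B` acts on the arrows ending at a vertex through the character of this vertex. -/
theorem mul_arrow {x : V} (a : ArrowsFrom x) (b : RadSqZero k V) :
    b * arrow k a = simpleChar k a.1 b • arrow k a := by
  classical
  have : LinearMap.mulRight k (arrow k a) =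
      (simpleChar k a.1).toLinearMap.smulRight (arrow k a) := by
    refine lhom_ext_toB k fun ⟨c, d, q⟩ _ => ?_
    simp only [LinearMap.mulRight_apply, LinearMap.smulRight_apply, AlgHom.toLinearMap_apply,
      simpleChar_toB]
    by_cases h : a.1 = c
    · subst h
      rw [arrow, ArrowsFrom.toOPath, toB_mul_eq]
      -- A path of positive length composed with the arrow has length at least two, so only the
      -- vertex at the target of the arrow contributes.
      by_cases hq : q.length = 0
      · obtain rfl := Quiver.Path.eq_of_length_zero q hq
        obtain rfl := Quiver.Path.eq_nil_of_length_zero q hq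
        simp
      · rw [toB_ofPath_eq_zero]
        · simp [hq]
        · simp only [Quiver.Path.length_comp, Quiver.Path.length_toPath]
          lia
    · rw [arrow, toB_mul_of_ne k h, if_neg fun h' => h h'.2.symm, zero_smul]
  exact LinearMap.congr_fun this b

open Classical in
/-- The coefficient of an arrow in an element of `B`. -/
noncomputable def coeff {x : V} (a : ArrowsFrom x) : RadSqZero k V →ₗ[k] k :=
  ((idealQ₂ k V).asIdeal.restrictScalars k).liftQ
    (extend k fun p => if p = a.toOPath then (1 : k) else 0) (fun c hc => by
      -- The functional descends to $B$ because an arrow is not a path of length at least two.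
      refine LinearMap.mem_ker.2 (eq_zero_of_mem_idealQ₂ k _ (fun p hp => ?_) hc)
      rw [extend_ofPath, if_neg]
      rintro rfl
      simp [ArrowsFrom.toOPath] at hp)

open Classical in
theorem coeff_toB {x : V} (a : ArrowsFrom x) (p : OPath V) :
    coeff k a (toB k V (ofPath k p)) = if p = a.toOPath then 1 else 0 := by
  rw [← extend_ofPath k (fun p => if p = a.toOPath then (1 : k) else 0) p]
  rfl

open Classical in
theorem coeff_arrow {x : V} (a b : ArrowsFrom x) :
    coeff k a (arrow k b) = if b = a then 1 else 0 := by
  rw [arrow, coeff_toB]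
  simp only [(ArrowsFrom.toOPath_injective x).eq_iff]

/-- The elements of `Bx` are combinations of the vertex `x` and of the arrows starting at `x`. -/
theorem mul_idem (x : V) [Fintype (ArrowsFrom x)] (b : RadSqZero k V) :
    b * idem k x = simpleChar k x b • idem k x + ∑ a : ArrowsFrom x, coeff k a b • arrow k a := by
  classical
  have : LinearMap.mulRight k (idem k x) =
      (simpleChar k x).toLinearMap.smulRight (idem k x) +
        ∑ a : ArrowsFrom x, (coeff k a).smulRight (arrow k a) := by
    refine lhom_ext_toB k (length_lt_two_cases (fun z => ?_) fun z b => ?_)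
    · have h0 (a : ArrowsFrom x) : coeff k a (idem k z) = 0 := by
        rw [← toB_vertex, vertex, coeff_toB, if_neg]
        intro h
        simpa [ArrowsFrom.toOPath] using congrArg (fun p => p.path.length) h
      change idem k z * idem k x = (LinearMap.smulRight _ _ + _ : _ →ₗ[k] _) (idem k z)
      simp only [LinearMap.add_apply, LinearMap.sum_apply, LinearMap.smulRight_apply,
        AlgHom.toLinearMap_apply, h0, zero_smul, Finset.sum_const_zero, add_zero]
      by_cases h : z = x
      · subst h
        rw [simpleChar_idem_self, one_smul, idem_mul_idem]
      · rw [simpleChar_idem_of_ne k h, zero_smul]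
        exact toB_mul_of_ne k (p := ⟨x, x, .nil⟩) (q := ⟨z, z, .nil⟩) (Ne.symm h)
    · change arrow k b * idem k x = (LinearMap.smulRight _ _ + _ : _ →ₗ[k] _) (arrow k b)
      simp only [LinearMap.add_apply, LinearMap.sum_apply, LinearMap.smulRight_apply,
        AlgHom.toLinearMap_apply, simpleChar_arrow, zero_smul, zero_add]
      by_cases h : z = x
      · subst h
        simp [coeff_arrow, arrow_mul_idem]
      · rw [Finset.sum_eq_zero]
        · exact toB_mul_of_ne k (p := ⟨x, x, .nil⟩) (q := b.toOPath) (Ne.symm h)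
        · intro a _
          rw [arrow, coeff_toB, if_neg, zero_smul]
          exact fun h' => h (congrArg OPath.src h')
  simpa using LinearMap.congr_fun this b

/-- If no arrow ends at `e`, then `eB` is spanned by `e`. -/
theorem idem_mul_of_isSource {e : V} (he : IsSource e) (b : RadSqZero k V) :
    idem k e * b = simpleChar k e b • idem k e := by
  classical
  have : LinearMap.mulLeft k (idem k e) =
      (simpleChar k e).toLinearMap.smulRight (idem k e) := by
    refine lhom_ext_toB k (length_lt_two_cases (fun z => ?_) fun z a => ?_)
    · change idem k e * idem k z = simpleChar k e (idem k z) • idem k e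
      by_cases h : z = e
      · subst h
        rw [simpleChar_idem_self, one_smul, idem_mul_idem]
      · rw [simpleChar_idem_of_ne k h, zero_smul]
        exact toB_mul_of_ne k (p := ⟨z, z, .nil⟩) (q := ⟨e, e, .nil⟩) h
    · change idem k e * arrow k a = simpleChar k e (arrow k a) • idem k e
      rw [simpleChar_arrow, zero_smul]
      refine toB_mul_of_ne k (p := a.toOPath) (q := ⟨e, e, .nil⟩) ?_
      obtain ⟨w, a⟩ := a
      rintro rfl
      exact (he z).elim a
  exact LinearMap.congr_fun this b

end Algebra

/-! ### The sequence $0\to\mathrm{rad}\,P_x\to P_x\to S_x\to 0$ -/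

section Modules

section Coordinates

variable (k : Type u₁) [Field k] {V : Type u₂}

/-- The basis vector of the simple module at `x`. -/
def simpleGen (x : V) : SimpleAt.{u₁, u₂, u₃} k x := ULift.up 1

/-- The coordinate of an element of the simple module at `x`. -/
def simpleCoord (x : V) : SimpleAt.{u₁, u₂, u₃} k x →+ k := AddEquiv.ulift.toAddMonoidHom

variable {k}

theorem simpleCoord_injective {x : V} : Function.Injective (simpleCoord.{u₁, u₂, u₃} k x) :=
  ULift.down_injective

@[simp] theorem simpleCoord_gen (x : V) :
    simpleCoord.{u₁, u₂, u₃} k x (simpleGen.{u₁, u₂, u₃} k x) = 1 := rfl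

end Coordinates

variable {k : Type u₁} [Field k] {V : Type u₂} [Quiver.{u₃} V] [Fintype V]

@[simp] theorem simpleCoord_smul {x : V} (b : RadSqZero k V) (m : SimpleAt k x) :
    simpleCoord k x (b • m) = simpleChar k x b * simpleCoord k x m := rfl

theorem smul_eq_zero_of_simpleChar {x : V} {b : RadSqZero k V} (hb : simpleChar k x b = 0)
    (m : SimpleAt k x) : b • m = 0 :=
  simpleCoord_injective (by rw [simpleCoord_smul, hb, zero_mul, map_zero])

theorem algebraMap_smul_simpleGen {x : V} (m : SimpleAt k x) :
    algebraMap k (RadSqZero k V) (simpleCoord k x m) • simpleGen k x = m :=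
  simpleCoord_injective (by
    rw [simpleCoord_smul, AlgHom.commutes, simpleCoord_gen, mul_one]; rfl)

variable (k)

/-- The carrier of the projective module `P_x = Bx`. -/
noncomputable abbrev ProjectiveAt (x : V) : Submodule (RadSqZero k V) (RadSqZero k V) :=
  LinearMap.range (LinearMap.toSpanSingleton (RadSqZero k V) (RadSqZero k V) (idem k x))

variable {k}

theorem mul_idem_of_mem {x : V} {b : RadSqZero k V} (hb : b ∈ ProjectiveAt k x) :
    b * idem k x = b := by
  obtain ⟨c, rfl⟩ := hb
  simp [mul_assoc, idem_mul_idem]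

theorem mem_projectiveAt {x : V} {b : RadSqZero k V} (hb : b * idem k x = b) :
    b ∈ ProjectiveAt k x := ⟨b, hb⟩

variable (k)

/-- Right multiplication by the idempotent $x$ retracts $B$ onto $Bx$, so $P_x$ is a direct summand
of $B$. -/
instance projective_P (x : V) : Projective (P k x) := by
  refine (IsProjective.iff_projective (ProjectiveAt k x)).1 ?_
  refine Module.Projective.of_split (ProjectiveAt k x).subtype
    (LinearMap.toSpanSingleton _ _ (idem k x)).rangeRestrict ?_
  ext ⟨b, hb⟩
  exact mul_idem_of_mem hb

/-- The projection of `P_x` onto its top. -/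
noncomputable def projTop (x : V) : ProjectiveAt k x →ₗ[RadSqZero k V] SimpleAt k x :=
  LinearMap.toSpanSingleton (RadSqZero k V) (SimpleAt k x) (simpleGen k x) ∘ₗ
    (ProjectiveAt k x).subtype

theorem simpleCoord_projTop {x : V} (m : ProjectiveAt k x) :
    simpleCoord k x (projTop k x m) = simpleChar k x m.1 :=
  (simpleCoord_smul m.1 (simpleGen k x)).trans (mul_one _)

theorem projTop_surjective (x : V) : Function.Surjective (projTop k x) := fun m =>
  ⟨⟨algebraMap k _ (simpleCoord k x m) * idem k x,
    mem_projectiveAt (by rw [mul_assoc, idem_mul_idem])⟩, simpleCoord_injective (by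
      rw [simpleCoord_projTop, map_mul, simpleChar_idem_self, mul_one, AlgHom.commutes]; rfl)⟩

variable [∀ x : V, Fintype (ArrowsFrom x)]

/-- The inclusion in `P_x` of its radical, a sum of simple modules indexed by the arrows
starting at `x`. -/
noncomputable def radInclusion (x : V) :
    (Π a : ArrowsFrom x, SimpleAt k a.1) →ₗ[RadSqZero k V] ProjectiveAt k x where
  toFun m := ⟨∑ a, simpleCoord k a.1 (m a) • arrow k a, mem_projectiveAt (by
    simp only [Finset.sum_mul, smul_mul_assoc, arrow_mul_idem])⟩
  map_add' m m' := Subtype.ext (by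
    simp only [Pi.add_apply, map_add, add_smul, Finset.sum_add_distrib, Submodule.coe_add])
  -- By `mul_arrow`, $b$ acts on an arrow ending at $z$ by the same scalar as on $S_z$.
  map_smul' b m := Subtype.ext (by
    simp only [Pi.smul_apply, simpleCoord_smul, RingHom.id_apply, Submodule.coe_smul,
      smul_eq_mul, Finset.mul_sum, mul_smul_comm, mul_arrow, smul_smul, mul_comm])

theorem coe_radInclusion {x : V} (m : Π a : ArrowsFrom x, SimpleAt k a.1) :
    (radInclusion k x m).1 = ∑ a, simpleCoord k a.1 (m a) • arrow k a := rfl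

/-- The functional `coeff k a` recovers the coordinate at $a$. -/
theorem radInclusion_injective (x : V) : Function.Injective (radInclusion k x) := by
  classical
  intro m m' h
  ext a
  have := congrArg (fun b => coeff k a b.1) h
  simp only [coe_radInclusion, map_sum, map_smul, coeff_arrow, smul_eq_mul, mul_ite, mul_one,
    mul_zero, Finset.sum_ite_eq', Finset.mem_univ, if_true] at this
  exact simpleCoord_injective this

/-- An element of $Bx$ killed by the character at $x$ has no vertex term in the expansion
`mul_idem`; its arrow coefficients are the coordinates of the preimage. Conversely, characters
vanish on arrows. -/
theorem exact_radInclusion_projTop (x : V) :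
    Function.Exact (radInclusion k x) (projTop k x) := by
  intro b
  constructor
  · intro hb
    have hb' : simpleChar k x b.1 = 0 := by rw [← simpleCoord_projTop, hb, map_zero]
    have h := mul_idem k x b.1
    rw [mul_idem_of_mem b.2, hb', zero_smul, zero_add] at h
    exact ⟨fun a => (ULift.up (coeff k a b.1) : SimpleAt k a.1), Subtype.ext h.symm⟩
  · rintro ⟨m, rfl⟩
    refine simpleCoord_injective ?_
    simp only [simpleCoord_projTop, coe_radInclusion, map_sum, map_smul, simpleChar_arrow,
      smul_zero, Finset.sum_const_zero, map_zero]

/-- The sequence `0 → rad P_x → P_x → S_x → 0`. -/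
noncomputable abbrev topSequence (x : V) :
    ShortComplex (ModuleCat.{max u₁ u₂ u₃} (RadSqZero k V)) :=
  ModuleCat.shortComplexOfCompEqZero (radInclusion k x) (projTop k x)
    (LinearMap.ext fun m => (exact_radInclusion_projTop k x).apply_apply_eq_zero m)

theorem topSequence_shortExact (x : V) : (topSequence k x).ShortExact :=
  ModuleCat.shortComplex_shortExact _ (exact_radInclusion_projTop k x)
    (radInclusion_injective k x) (projTop_surjective k x)

/-- A morphism from `P_x` to a simple module vanishes on the radical. -/
theorem topSequence_f_comp (x y : V) (g : P k x ⟶ S k y) : (topSequence k x).f ≫ g = 0 := by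
  ext m
  let g' : ProjectiveAt k x →ₗ[RadSqZero k V] SimpleAt k y := g.hom
  change g' (radInclusion k x m) = 0
  -- An element $r$ of the radical equals $r\cdot x$, so $g(r)=r\,g(x)$; as a combination of arrows,
  -- $r$ acts as zero on $S_y$.
  have h : radInclusion k x m = (radInclusion k x m).1 •
      (⟨idem k x, mem_projectiveAt (idem_mul_idem k x)⟩ : ProjectiveAt k x) :=
    Subtype.ext (mul_idem_of_mem (radInclusion k x m).2).symm
  rw [h, map_smul]
  refine smul_eq_zero_of_simpleChar ?_ _
  simp only [coe_radInclusion, map_sum, map_smul, simpleChar_arrow, smul_zero,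
    Finset.sum_const_zero]

/-- The radical of `P_x` as a bicone over the simple modules at the targets of the arrows. -/
noncomputable def radBicone (x : V) : Limits.Bicone fun a : ArrowsFrom x => S k a.1 := by
  classical
  exact
  { pt := ModuleCat.of _ (Π a : ArrowsFrom x, SimpleAt k a.1)
    π := fun a => ModuleCat.ofHom (LinearMap.proj a)
    ι := fun a => ModuleCat.ofHom
      (LinearMap.single (RadSqZero k V) (fun a : ArrowsFrom x => SimpleAt k a.1) a)
    ι_π := fun a b => by
      split_ifs with h
      · subst h
        ext m
        exact Pi.single_eq_same (M := fun a : ArrowsFrom x => SimpleAt k a.1) a m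
      · ext m
        exact Pi.single_eq_of_ne (M := fun a : ArrowsFrom x => SimpleAt k a.1) (Ne.symm h) m }

noncomputable def radBicone_isBilimit (x : V) : (radBicone k x).IsBilimit :=
  Limits.isBilimitOfTotal _ (by
    classical
    ext m
    simp only [ModuleCat.hom_sum, LinearMap.sum_apply]
    exact Finset.univ_sum_single (M := fun a : ArrowsFrom x => SimpleAt k a.1) m)

/-- `Ext^{n+1}(S_x, S_y)` is the product of the `Ext^n(S_z, S_y)` over the arrows `x → z`. -/
noncomputable def extSimpleSuccLinearEquiv (x y : V) (n : ℕ) :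
    (Π a : ArrowsFrom x, Abelian.Ext (S k a.1) (S k y) n) ≃ₗ[k]
      Abelian.Ext (S k x) (S k y) (n + 1) :=
  haveI : Projective (topSequence k x).X₂ := projective_P k x
  (extBiproductLinearEquiv k (radBicone_isBilimit k x) (S k y) n).symm ≪≫ₗ
    extShiftLinearEquiv k (topSequence_shortExact k x) (S k y) (topSequence_f_comp k x y) n

end Modules

/-! ### Ext between simple modules; sinks and sources -/

section Simples

variable {k : Type u₁} [Field k] {V : Type u₂} [Quiver.{u₃} V] [Fintype V]

/-- A homomorphism between simple modules is determined by the image of the basis vector. -/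
theorem simpleCoord_map {x y : V} (g : SimpleAt k x →ₗ[RadSqZero k V] SimpleAt k y)
    (m : SimpleAt k x) :
    simpleCoord k y (g m) = simpleCoord k x m * simpleCoord k y (g (simpleGen k x)) := by
  conv_lhs => rw [← algebraMap_smul_simpleGen m]
  rw [map_smul, simpleCoord_smul, AlgHom.commutes]
  rfl

/-- The idempotent $y$ kills the generator of $S_x$ but is the identity on $S_y$. -/
theorem linearMap_simple_eq_zero {x y : V} (h : x ≠ y)
    (g : SimpleAt k x →ₗ[RadSqZero k V] SimpleAt k y) : g = 0 := by
  have hg : simpleCoord k y (g (simpleGen k x)) = 0 := by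
    have h₁ : idem k y • simpleGen k x = 0 :=
      smul_eq_zero_of_simpleChar (simpleChar_idem_of_ne k (Ne.symm h)) _
    have h₂ := simpleCoord_smul (idem k y) (g (simpleGen k x))
    rwa [← map_smul, h₁, map_zero, map_zero, simpleChar_idem_self, one_mul, eq_comm] at h₂
  refine LinearMap.ext fun m => simpleCoord_injective ?_
  rw [simpleCoord_map, hg, mul_zero, LinearMap.zero_apply, map_zero]

variable (k)

theorem rank_hom_simple_self (x : V) : Module.rank k (S k x ⟶ S k x) = 1 := by
  refine rank_eq_one (𝟙 (S k x)) (fun h => ?_) fun f => ?_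
  · have := congrArg (fun g : S k x ⟶ S k x =>
      simpleCoord k x ((g.hom : SimpleAt k x →ₗ[RadSqZero k V] SimpleAt k x) (simpleGen k x))) h
    exact one_ne_zero (α := k) this
  · let g : SimpleAt k x →ₗ[RadSqZero k V] SimpleAt k x := f.hom
    refine ⟨simpleCoord k x (g (simpleGen k x)), ?_⟩
    ext m
    let m' : SimpleAt k x := m
    change algebraMap k (RadSqZero k V) (simpleCoord k x (g (simpleGen k x))) • m' = g m'
    refine simpleCoord_injective ?_
    rw [simpleCoord_map g m', simpleCoord_smul, AlgHom.commutes, mul_comm]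
    rfl

theorem rank_hom_simple_of_ne {x y : V} (h : x ≠ y) : Module.rank k (S k x ⟶ S k y) = 0 := by
  have : Subsingleton (S k x ⟶ S k y) :=
    ⟨fun f g => ModuleCat.hom_ext ((linearMap_simple_eq_zero h f.hom).trans
      (linearMap_simple_eq_zero h g.hom).symm)⟩
  exact rank_subsingleton' _ _

/-- Induction on $n$ with $y$ fixed and $x$ varying, since the shift replaces $x$ by the targets of
its arrows. -/
theorem rank_ext_simple [∀ x y : V, Finite (x ⟶ y)] (x y : V) (n : ℕ) :
    Module.rank k (Abelian.Ext (S k x) (S k y) n) =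
      ((pathsOfLength n x y).ncard : Cardinal) := by
  have (x : V) : Fintype (ArrowsFrom x) := Fintype.ofFinite _
  induction n generalizing x with
  | zero =>
    rw [(Abelian.Ext.linearEquiv₀ (R := k)).rank_eq]
    by_cases h : x = y
    · subst h
      rw [rank_hom_simple_self, pathsOfLength_zero_self, Set.ncard_singleton, Nat.cast_one]
    · rw [rank_hom_simple_of_ne k h, pathsOfLength_zero_of_ne h, Set.ncard_empty, Nat.cast_zero]
  | succ n ih =>
    -- The induction hypothesis bounds the rank by a natural number; this finiteness lets `finrank`
    -- compute the rank of the product as a sum.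
    have (a : ArrowsFrom x) : Module.Finite k (Abelian.Ext (S k a.1) (S k y) n) :=
      Module.rank_lt_aleph0_iff.1 (by rw [ih]; exact Cardinal.natCast_lt_aleph0)
    rw [← (extSimpleSuccLinearEquiv k x y n).rank_eq, ← Module.finrank_eq_rank,
      Module.finrank_pi_fintype, ncard_pathsOfLength_succ]
    simp only [fun z => Module.finrank_eq_of_rank_eq (ih z)]

/-- The projective module at a sink is simple. -/
noncomputable def projectiveIsoSimple {f : V} (hf : IsSink f) : P k f ≅ S k f :=
  LinearEquiv.toModuleIso <| LinearEquiv.ofBijective (projTop k f) <| by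
    have : IsEmpty (ArrowsFrom f) := ⟨fun a => (hf a.1).elim a.2⟩
    have : Fintype (ArrowsFrom f) := Fintype.ofIsEmpty
    refine ⟨(injective_iff_map_eq_zero _).2 fun b hb => Subtype.ext ?_, projTop_surjective k f⟩
    -- With no arrows leaving $f$, the expansion leaves only the multiple of $f$ detected by the
    -- character.
    have h := mul_idem k f b.1
    rwa [mul_idem_of_mem b.2, Finset.univ_eq_empty, Finset.sum_empty, add_zero, ← simpleCoord_projTop, hb, map_zero,
      zero_smul] at h

/-- The vertex `x` as an element of `xB`. -/
noncomputable def idemRight (x : V) : rightIdeal k x := ⟨idem k x, 1, mul_one _⟩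

/-- Evaluation at the vertex, as a map from the injective module at a source to the simple one. -/
noncomputable def injectiveEval {e : V} (he : IsSource e) :
    InjectiveAt k e →ₗ[RadSqZero k V] SimpleAt k e where
  toFun φ := ULift.up ((show rightIdeal k e →ₗ[k] k from φ) (idemRight k e))
  map_add' _ _ := rfl
  map_smul' b φ := by
    refine simpleCoord_injective ?_
    let φ' : rightIdeal k e →ₗ[k] k := φ
    change φ' (rightMul k e b (idemRight k e)) = simpleChar k e b * φ' (idemRight k e)
    have : rightMul k e b (idemRight k e) = simpleChar k e b • idemRight k e :=
      Subtype.ext (idem_mul_of_isSource k he b)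
    rw [this, map_smul, smul_eq_mul]

/-- As $eB=ke$ is a line, a functional on it is determined by its value at $e$, and that value is
arbitrary. -/
theorem injectiveEval_bijective {e : V} (he : IsSource e) :
    Function.Bijective (injectiveEval k he) := by
  constructor
  · intro φ ψ h
    have h' : (show rightIdeal k e →ₗ[k] k from φ) (idemRight k e) =
      (show rightIdeal k e →ₗ[k] k from ψ) (idemRight k e) := congrArg ULift.down h
    refine LinearMap.ext fun m => ?_
    obtain ⟨_, b, rfl⟩ := m
    have : (⟨LinearMap.mulLeft k (idem k e) b, b, rfl⟩ : rightIdeal k e) =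
        simpleChar k e b • idemRight k e :=
      Subtype.ext (idem_mul_of_isSource k he b)
    rw [this]
    refine (map_smul (show rightIdeal k e →ₗ[k] k from φ) _ _).trans ?_
    rw [h']
    exact (map_smul (show rightIdeal k e →ₗ[k] k from ψ) _ _).symm
  · intro m
    -- The character at $e$, restricted to $eB$, takes the value $1$ at $e$; it is scaled to the
    -- prescribed value.
    refine ⟨simpleCoord k e m • ((simpleChar k e).toLinearMap ∘ₗ (rightIdeal k e).subtype),
      simpleCoord_injective ?_⟩
    change simpleCoord k e m * simpleChar k e (idem k e) = _
    rw [simpleChar_idem_self, mul_one]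

/-- The injective module at a source is simple. -/
noncomputable def injectiveIsoSimple {e : V} (he : IsSource e) : I k e ≅ S k e :=
  (LinearEquiv.ofBijective (injectiveEval k he) (injectiveEval_bijective k he)).toModuleIso

end Simples

end QuiverAlg

theorem mainTheorem10 (k : Type u₁) [Field k] (V : Type u₂) [Quiver.{u₃} V]
    [Fintype V] [∀ x y : V, Finite (x ⟶ y)] :
    (Subsingleton (Quiver.WeaklyConnectedComponent V) → 1 < Fintype.card V →
      ∀ e f : V, QuiverAlg.IsSource e → QuiverAlg.IsSink f → ∀ n : ℕ, 2 ≤ n →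
        Module.rank k (Abelian.Ext (QuiverAlg.I k e) (QuiverAlg.P k f) n) =
          ((QuiverAlg.pathsOfLength n e f).ncard : Cardinal)) ∧
    (∀ (x y : V) (n : ℕ),
      Module.rank k (Abelian.Ext (QuiverAlg.S k x) (QuiverAlg.S k y) n) =
        ((QuiverAlg.pathsOfLength n x y).ncard : Cardinal)) := by
  refine ⟨fun _ _ e f he hf n _ => ?_, QuiverAlg.rank_ext_simple k⟩
  -- Part (b) for $S_e$ and $S_f$, transported along $P_f\cong S_f$ and $I_e\cong S_e$.
  rw [← QuiverAlg.rank_ext_simple k e f n,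
    (QuiverAlg.extPostcompIso k (QuiverAlg.projectiveIsoSimple k hf) (QuiverAlg.I k e) n).rank_eq,
    (QuiverAlg.extPrecompIso k (QuiverAlg.injectiveIsoSimple k he) (QuiverAlg.S k f) n).rank_eq]
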